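/- Let $\varphi:\mathbb{R}^n\to\mathcal{F}$ be a feature map into a real inner product space, let $k(x,y)=\langle\varphi(x),\varphi(y)\rangle_{\mathcal F}$ be its kernel, and for $X=(x_1,\dots,x_s)\in\mathbb{R}^{n\times s}$ let $K(X)=K(X,X)\in\mathbb{R}^{s\times s}$ be the kernel matrix, $K(X)_{ij}=k(x_i,x_j)$. Let $\mathcal{A}:\mathbb{R}^{n\times s}\to\mathbb{R}^m$ be linear, $b\in\mathbb{R}^m$, and $\mathcal{L}_{\mathcal{A},b}=\{X\in\mathbb{R}^{n\times s}:\mathcal{A}(X)=b\}$, an affine manifold with tangent space $\mathrm{null}(\mathcal{A})$. Let $\mathrm{Grass}(s,r)$ be the Grassmann manifold of $r$-dimensional subspaces of $\mathbb{R}^s$; if $W\in\mathbb{R}^{s\times r}$ has orthonormal columns spanning $\mathcal{W}$, tangent vectors at $\mathcal{W}$ are represented by the matrices $H\in\mathbb{R}^{s\times r}$ with $W^\top H=0$. Both manifolds carry the metric $\langle A,B\rangle=\mathrm{trace}(A^\top B)$, and $\|\cdot\|_F$ denotes the Frobenius norm. On $\mathcal{M}=\mathcal{L}_{\mathcal{A},b}\times\mathrm{Grass}(s,r)$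 consider the cost $$f(X,\mathcal{W})=\mathrm{trace}\big(P_{\mathcal{W}^\perp}K(X,X)\big),$$ where $P_{\mathcal{W}^\perp}$ is the orthogonal projection onto $\mathcal{W}^\perp$, and let $\mathrm{Retr}$ be the exponential map of $\mathcal{M}$, that is, $\mathrm{Retr}_{(X,\mathcal{W})}(\eta_x,\eta_u)=(X+\eta_x,\mathrm{Exp}_{\mathcal{W}}(\eta_u))$. (1) Suppose that $X\mapsto K(X,X)$ is differentiable at every point of $\mathcal{L}_{\mathcal{A},b}$ and that its derivative $\mathrm{D}K$ is Lipschitz continuous on $\mathcal{L}_{\mathcal{A},b}$ with constant $L$ in the Frobenius norm, $\|\mathrm{D}K(X_1)-\mathrm{D}K(X_2)\|_F\le L\|X_1-X_2\|_F$ for all $X_1,X_2\in\mathcal{L}_{\mathcal{A},b}$, where the Frobenius norm of a linear map $\mathbb{R}^{n\times s}\to\mathbb{R}^{s\times s}$ is the square root of the sum of the squares of its matrix entries. Then for all $(X,\mathcal{W})\in\mathcal{M}$ and all $\eta_x\in\mathrm{null}(\mathcal{A})$, the Riemannian gradient $\mathrm{grad}_Xf(X,\mathcal{W})$ exists and $$\Big|f\big(\mathrm{Retr}_{(X,\mathcal{W})}(\eta_x,0)\big)-\big[f(X,\mathcal{W})+\langle\mathrm{grad}_Xf(X,\mathcal{W}),\eta_x\rangle\big]\Big|\le\frac{L_x}{2}\|\eta_x\|_F^2$$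 with $L_x=L$. If instead $\mathrm{D}K$ is Lipschitz continuous on $\mathcal{L}_{\mathcal{A},b}$ with constant $L$ in the operator norm induced by the Frobenius norms, the same holds with $L_x=\sqrt{s-r}\,L$. (2) If $\|K(X,X)\|_F\le M$ for all $X\in\mathcal{L}_{\mathcal{A},b}$, then for all $(X,\mathcal{W})\in\mathcal{M}$ and all $\eta_u\in\mathrm{T}_{\mathcal{W}}\mathrm{Grass}(s,r)$, the Riemannian gradient $\mathrm{grad}_{\mathcal{W}}f(X,\mathcal{W})$ exists and $$\Big|f\big(\mathrm{Retr}_{(X,\mathcal{W})}(0,\eta_u)\big)-\big[f(X,\mathcal{W})+\langle\mathrm{grad}_{\mathcal{W}}f(X,\mathcal{W}),\eta_u\rangle\big]\Big|\le\frac{L_u}{2}\|\eta_u\|_F^2,\qquad L_u=2M.$$ -/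

import Mathlib

open scoped Matrix
open scoped Matrix.Norms.Frobenius

/-! Throughout, `Matrix (Fin p) (Fin q) ℝ` carries the Frobenius norm. -/

namespace KernelRecovery

/-- The inner product `trace (Aᵀ B)` of two real matrices. -/
def frobInner {p q : ℕ} (A B : Matrix (Fin p) (Fin q) ℝ) : ℝ := (Aᵀ * B).trace

/-- The kernel matrix `K(X, X)`, with entries `k(xᵢ, xⱼ) = ⟨φ(xᵢ), φ(xⱼ)⟩`, where `xᵢ` is the
`i`-th column of `X` and `φ` is the feature map. -/
noncomputable def kernelMatrix {F : Type*} [NormedAddCommGroup F] [InnerProductSpace ℝ F]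
    {n s : ℕ} (φ : (Fin n → ℝ) → F) (X : Matrix (Fin n) (Fin s) ℝ) :
    Matrix (Fin s) (Fin s) ℝ :=
  Matrix.of fun i j => inner ℝ (φ (Xᵀ i)) (φ (Xᵀ j))

/-- The affine space `{X : 𝒜(X) = b}` of matrices that fit the measurements. -/
def measurementSpace {n s m : ℕ} (𝒜 : Matrix (Fin n) (Fin s) ℝ →ₗ[ℝ] (Fin m → ℝ))
    (b : Fin m → ℝ) : Set (Matrix (Fin n) (Fin s) ℝ) :=
  {X | 𝒜 X = b}

/-- The matrix of the orthogonal projection onto a subspace of `ℝˢ`. -/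
noncomputable def projMatrix {s : ℕ} (𝒲 : Submodule ℝ (EuclideanSpace ℝ (Fin s))) :
    Matrix (Fin s) (Fin s) ℝ :=
  (Matrix.toEuclideanCLM (𝕜 := ℝ) (n := Fin s)).symm 𝒲.starProjection

/-- The cost `f(X, 𝒲) = trace (P_{𝒲⊥} K(X, X))`. -/
noncomputable def kernelCost {F : Type*} [NormedAddCommGroup F] [InnerProductSpace ℝ F]
    {n s : ℕ} (φ : (Fin n → ℝ) → F) (X : Matrix (Fin n) (Fin s) ℝ)
    (𝒲 : Submodule ℝ (EuclideanSpace ℝ (Fin s))) : ℝ :=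
  (projMatrix 𝒲ᗮ * kernelMatrix φ X).trace

/-- The Stiefel manifold of `s × r` matrices with orthonormal columns. -/
def stiefel (s r : ℕ) : Set (Matrix (Fin s) (Fin r) ℝ) := {W | Wᵀ * W = 1}

/-- The Grassmann manifold, as the set of `r`-dimensional subspaces of `ℝˢ`. -/
def grass (s r : ℕ) : Set (Submodule ℝ (EuclideanSpace ℝ (Fin s))) :=
  {𝒲 | Module.finrank ℝ 𝒲 = r}

/-- The column space of an `s × r` matrix, as a subspace of `ℝˢ`. -/
noncomputable def colSpace {s r : ℕ} (W : Matrix (Fin s) (Fin r) ℝ) :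
    Submodule ℝ (EuclideanSpace ℝ (Fin s)) :=
  LinearMap.range (Matrix.toEuclideanLin W)

/-- The tangent space of the Grassmann manifold at the column space of `W`, in the representation
given by `W` (horizontal lift): all `H` with `Wᵀ H = 0`. -/
def horizontal {s r : ℕ} (W : Matrix (Fin s) (Fin r) ℝ) :
    Submodule ℝ (Matrix (Fin s) (Fin r) ℝ) where
  carrier := {H | Wᵀ * H = 0}
  add_mem' {A B} hA hB := by
    simp only [Set.mem_ofPred_eq] at *
    rw [Matrix.mul_add, hA, hB, add_zero]
  zero_mem' := by simp
  smul_mem' c A hA := by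
    simp only [Set.mem_ofPred_eq] at *
    rw [Matrix.mul_smul, hA, smul_zero]

/-- Horizontal lift to the Stiefel manifold of a geodesic of the Grassmann manifold
`St(s, r) / O(r)`: a horizontal curve on the Stiefel manifold whose acceleration is
orthogonal to the tangent space `{Z : Wᵀ Z + Zᵀ W = 0}` of the Stiefel manifold. -/
def IsHorizontalGeodesic {s r : ℕ} (γ : ℝ → Matrix (Fin s) (Fin r) ℝ) : Prop :=
  ∃ γ₁ γ₂ : ℝ → Matrix (Fin s) (Fin r) ℝ,
    (∀ t, HasDerivAt γ (γ₁ t) t) ∧ (∀ t, HasDerivAt γ₁ (γ₂ t) t) ∧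
    (∀ t, γ t ∈ stiefel s r) ∧ (∀ t, γ₁ t ∈ horizontal (γ t)) ∧
    ∀ t, ∀ Z : Matrix (Fin s) (Fin r) ℝ, (γ t)ᵀ * Z + Zᵀ * γ t = 0 → frobInner (γ₂ t) Z = 0

/-- The geodesic through `W` with velocity `H`, in closed form. -/
noncomputable def grassGeodesic {s r : ℕ} (W H : Matrix (Fin s) (Fin r) ℝ) (t : ℝ) :
    Matrix (Fin s) (Fin r) ℝ :=
  NormedSpace.exp (t • (H * Wᵀ - W * Hᵀ)) * W

/-- The exponential map of the Grassmann manifold at the column space of `W`, applied to the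
tangent vector represented by `H`: the point at time `1` of the geodesic. -/
noncomputable def grassExp {s r : ℕ} (W H : Matrix (Fin s) (Fin r) ℝ) :
    Submodule ℝ (EuclideanSpace ℝ (Fin s)) :=
  colSpace (grassGeodesic W H 1)

/-- The exponential map of the product manifold at the point `(X, colSpace W)`. -/
noncomputable def expRetr {n s r : ℕ} (X : Matrix (Fin n) (Fin s) ℝ)
    (W : Matrix (Fin s) (Fin r) ℝ) (ηx : Matrix (Fin n) (Fin s) ℝ)
    (ηu : Matrix (Fin s) (Fin r) ℝ) :
    Matrix (Fin n) (Fin s) ℝ × Submodule ℝ (EuclideanSpace ℝ (Fin s)) :=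
  (X + ηx, grassExp W ηu)

/-- `G` is the Riemannian gradient at `x`, with respect to the tangent space `T`, of the function
whose extension to the ambient matrix space is `g`: it is the tangent vector that represents the
differential of `g` on `T`, that is, the orthogonal projection onto `T` of the Euclidean
gradient. -/
def IsRiemannianGradient {p q : ℕ} (g : Matrix (Fin p) (Fin q) ℝ → ℝ)
    (x : Matrix (Fin p) (Fin q) ℝ) (T : Submodule ℝ (Matrix (Fin p) (Fin q) ℝ))
    (G : Matrix (Fin p) (Fin q) ℝ) : Prop :=
  G ∈ T ∧ DifferentiableAt ℝ g x ∧ ∀ Z ∈ T, fderiv ℝ g x Z = frobInner G Z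

/-- At every point of the product manifold, the function `f(·, 𝒲)` has a Riemannian gradient, and
`|f(Retr(ηx, 0)) - (f(X, 𝒲) + ⟨grad_X f(X, 𝒲), ηx⟩)| ≤ (Lx / 2) ‖ηx‖²` for all tangent `ηx`. -/
def PullbackLipschitzX {n s m : ℕ} (r : ℕ)
    (f : Matrix (Fin n) (Fin s) ℝ → Submodule ℝ (EuclideanSpace ℝ (Fin s)) → ℝ)
    (𝒜 : Matrix (Fin n) (Fin s) ℝ →ₗ[ℝ] (Fin m → ℝ)) (b : Fin m → ℝ) (Lx : ℝ) : Prop :=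
  ∀ X ∈ measurementSpace 𝒜 b, ∀ W ∈ stiefel s r,
    ∃ G, IsRiemannianGradient (fun Y => f Y (colSpace W)) X (LinearMap.ker 𝒜) G ∧
      ∀ ηx ∈ LinearMap.ker 𝒜,
        |Function.uncurry f (expRetr X W ηx 0) - (f X (colSpace W) + frobInner G ηx)|
          ≤ Lx / 2 * ‖ηx‖ ^ 2

/-- At every point of the product manifold, the function `f(X, ·)` has a Riemannian gradient, and
`|f(Retr(0, ηu)) - (f(X, 𝒲) + ⟨grad_𝒲 f(X, 𝒲), ηu⟩)| ≤ (Lu / 2) ‖ηu‖²` for all tangent `ηu`. -/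
def PullbackLipschitzU {n s m : ℕ} (r : ℕ)
    (f : Matrix (Fin n) (Fin s) ℝ → Submodule ℝ (EuclideanSpace ℝ (Fin s)) → ℝ)
    (𝒜 : Matrix (Fin n) (Fin s) ℝ →ₗ[ℝ] (Fin m → ℝ)) (b : Fin m → ℝ) (Lu : ℝ) : Prop :=
  ∀ X ∈ measurementSpace 𝒜 b, ∀ W ∈ stiefel s r,
    ∃ G, IsRiemannianGradient (fun V => f X (colSpace V)) W (horizontal W) G ∧
      ∀ ηu ∈ horizontal W,
        |Function.uncurry f (expRetr X W 0 ηu) - (f X (colSpace W) + frobInner G ηu)|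
          ≤ Lu / 2 * ‖ηu‖ ^ 2

/-- The derivative `DK(X)` of `X ↦ K(X, X)` at `X`, a linear map on `ℝⁿˣˢ`. -/
noncomputable def kernelDeriv {F : Type*} [NormedAddCommGroup F] [InnerProductSpace ℝ F]
    {n s : ℕ} (φ : (Fin n → ℝ) → F) (X : Matrix (Fin n) (Fin s) ℝ) :
    Matrix (Fin n) (Fin s) ℝ →ₗ[ℝ] Matrix (Fin s) (Fin s) ℝ :=
  (fderiv ℝ (kernelMatrix φ) X).toLinearMap

/-- The Frobenius (Hilbert-Schmidt) norm of a linear map between spaces of matrices: the square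
root of the sum of the squares of all entries of its matrix (for a derivative: of the Jacobian). -/
noncomputable def jacobianFrobNorm {n s : ℕ}
    (D : Matrix (Fin n) (Fin s) ℝ →ₗ[ℝ] Matrix (Fin s) (Fin s) ℝ) : ℝ :=
  Real.sqrt (∑ a, ∑ i, ‖D (Matrix.single a i 1)‖ ^ 2)

/-! The objects above are what their names say: orthonormal matrices represent exactly the points
of the Grassmann manifold, and `grassGeodesic W H` is the geodesic with initial velocity `H`. -/

theorem colSpace_mem_grass {s r : ℕ} {W : Matrix (Fin s) (Fin r) ℝ} (hW : W ∈ stiefel s r) :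
    colSpace W ∈ grass s r := by
  have hinj : Function.Injective (Matrix.toEuclideanLin W) := by
    intro x y hxy
    have h : W *ᵥ x.ofLp = W *ᵥ y.ofLp := by
      simpa [Matrix.toLpLin_apply] using hxy
    have h2 := congrArg (fun v => Wᵀ *ᵥ v) h
    simp only [Matrix.mulVec_mulVec] at h2
    rw [show Wᵀ * W = 1 from hW] at h2
    simp only [Matrix.one_mulVec] at h2
    exact WithLp.ofLp_injective 2 h2
  simp only [grass, colSpace, Set.mem_ofPred_eq]
  rw [LinearMap.finrank_range_of_inj hinj]
  simp

theorem exists_stiefel_of_mem_grass {s r : ℕ}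
    {𝒲 : Submodule ℝ (EuclideanSpace ℝ (Fin s))} (h : 𝒲 ∈ grass s r) :
    ∃ W ∈ stiefel s r, colSpace W = 𝒲 := by
  have h' : Module.finrank ℝ 𝒲 = r := h
  let e := (stdOrthonormalBasis ℝ 𝒲).reindex (finCongr h')
  let W : Matrix (Fin s) (Fin r) ℝ := Matrix.of fun i j => (e j : EuclideanSpace ℝ (Fin s)) i
  have hW : W ∈ stiefel s r := by
    change Wᵀ * W = 1
    ext i j
    have h1 := orthonormal_iff_ite.mp e.orthonormal j i
    rw [Submodule.coe_inner, PiLp.inner_apply] at h1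
    simp only [Matrix.mul_apply, Matrix.transpose_apply, Matrix.one_apply]
    simpa [W, eq_comm] using h1
  refine ⟨W, hW, ?_⟩
  refine Submodule.eq_of_le_of_finrank_eq ?_ ((colSpace_mem_grass hW).trans h'.symm)
  rintro _ ⟨x, rfl⟩
  have : Matrix.toEuclideanLin W x = ∑ j, x j • (e j : EuclideanSpace ℝ (Fin s)) := by
    ext i
    simp [Matrix.toLpLin_apply, Matrix.mulVec, dotProduct, W, mul_comm]
  rw [this]
  exact Submodule.sum_mem _ fun j _ => Submodule.smul_mem _ _ (e j).2

theorem isHorizontalGeodesic_grassGeodesic {s r : ℕ} {W H : Matrix (Fin s) (Fin r) ℝ}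
    (hW : W ∈ stiefel s r) (hH : H ∈ horizontal W) :
    IsHorizontalGeodesic (grassGeodesic W H) ∧ grassGeodesic W H 0 = W ∧
      HasDerivAt (grassGeodesic W H) H 0 := by
  have hW' : Wᵀ * W = 1 := hW
  have hH' : Wᵀ * H = 0 := hH
  have hHW : Hᵀ * W = 0 := by
    have := congrArg Matrix.transpose hH'
    simpa [Matrix.transpose_mul] using this
  obtain ⟨Ω, hΩ⟩ : ∃ Ω : Matrix (Fin s) (Fin s) ℝ, Ω = H * Wᵀ - W * Hᵀ := ⟨_, rfl⟩
  have hγ : grassGeodesic W H = fun t => NormedSpace.exp (t • Ω) * W := by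
    subst hΩ; rfl
  have hΩW : Ω * W = H := by
    rw [hΩ, Matrix.sub_mul, Matrix.mul_assoc, Matrix.mul_assoc, hW', hHW]; simp
  have hΩH : Ω * H = -(W * (Hᵀ * H)) := by
    rw [hΩ, Matrix.sub_mul, Matrix.mul_assoc, Matrix.mul_assoc, hH']; simp
  have hskew : Ωᵀ = -Ω := by
    rw [hΩ]; simp [Matrix.transpose_sub, Matrix.transpose_mul]
  have hexp : ∀ t : ℝ, (NormedSpace.exp (t • Ω))ᵀ * NormedSpace.exp (t • Ω) = 1 := by
    intro t
    rw [← Matrix.exp_transpose, Matrix.transpose_smul, hskew, smul_neg,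
      ← Matrix.exp_add_of_commute _ _ (Commute.refl (t • Ω)).neg_left, neg_add_cancel,
      NormedSpace.exp_zero]
  have hd : ∀ (V : Matrix (Fin s) (Fin r) ℝ) (t : ℝ),
      HasDerivAt (fun t : ℝ => NormedSpace.exp (t • Ω) * V)
        (NormedSpace.exp (t • Ω) * (Ω * V)) t := by
    intro V t
    let R : Matrix (Fin s) (Fin s) ℝ →ₗ[ℝ] Matrix (Fin s) (Fin r) ℝ :=
      { toFun := fun A => A * V
        map_add' := fun A B => Matrix.add_mul A B V
        map_smul' := fun c A => Matrix.smul_mul c A V }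
    have h1 := (LinearMap.toContinuousLinearMap R).hasFDerivAt.comp_hasDerivAt t
      (hasDerivAt_exp_smul_const Ω t)
    rw [← Matrix.mul_assoc]
    exact h1
  have hd0 := hd W
  rw [hΩW] at hd0
  refine ⟨⟨fun t => NormedSpace.exp (t • Ω) * H, fun t => NormedSpace.exp (t • Ω) * (Ω * H),
    fun t => hγ ▸ hd0 t, hd H, fun t => ?_, fun t => ?_, fun t Z hZ => ?_⟩, ?_, ?_⟩
  · change (grassGeodesic W H t)ᵀ * grassGeodesic W H t = 1
    rw [hγ]
    simp only [Matrix.transpose_mul]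
    rw [Matrix.mul_assoc, ← Matrix.mul_assoc _ _ W, hexp, Matrix.one_mul, hW']
  · change (grassGeodesic W H t)ᵀ * (NormedSpace.exp (t • Ω) * H) = 0
    rw [hγ]
    simp only [Matrix.transpose_mul]
    rw [Matrix.mul_assoc, ← Matrix.mul_assoc _ _ H, hexp, Matrix.one_mul, hH']
  · have h2 : NormedSpace.exp (t • Ω) * (Ω * H) = -(grassGeodesic W H t * (Hᵀ * H)) := by
      rw [hΩH, hγ, Matrix.mul_neg, Matrix.mul_assoc]
    change ((NormedSpace.exp (t • Ω) * (Ω * H))ᵀ * Z).trace = 0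
    rw [h2]
    generalize grassGeodesic W H t = U at hZ
    have e1 : ((Hᵀ * H) * (Zᵀ * U)).trace = ((Hᵀ * H) * (Uᵀ * Z)).trace := by
      rw [← Matrix.trace_transpose, Matrix.transpose_mul, Matrix.trace_mul_comm]
      simp [Matrix.transpose_mul]
    have e2 : ((Hᵀ * H) * (Uᵀ * Z + Zᵀ * U)).trace = 0 := by rw [hZ]; simp
    rw [Matrix.mul_add, Matrix.trace_add, e1] at e2
    have e3 : ((-(U * (Hᵀ * H)))ᵀ * Z).trace = -((Hᵀ * H) * (Uᵀ * Z)).trace := by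
      simp [Matrix.transpose_mul, Matrix.mul_assoc]
    rw [e3]
    linarith
  · rw [hγ]; simp
  · have h0 := hd0 0
    rw [zero_smul, NormedSpace.exp_zero, Matrix.one_mul] at h0
    rw [hγ]
    exact h0

end KernelRecovery

/-! Both bounds are one-variable Taylor estimates along geodesics.

In the `X` direction the cost is the linear functional `A ↦ tr (P A)`, `P = P_{𝒲⊥}`, composed with
`K`, so a Lipschitz bound on `tr (P DK(X + tη) η)` in `t` suffices. For the operator norm,
Cauchy-Schwarz and `‖P‖ = √(s - r)` give it. For the Frobenius norm the factor `√(s - r)`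
disappears: moving column `l` of `X` changes `K` only on row and column `l`, so only row `l` of `P`
matters, and idempotence of `P` controls that row (`abs_trace_mul_le_of_support_cross`).

In the Grassmann direction the cost along a lifted geodesic `γ` is `tr K - ⟨γ, Kγ⟩`. As `γ'' = -γ Hᵀ
H`, its second derivative is `-2 (⟨γ', Kγ'⟩ - ⟨γHᵀ, KγHᵀ⟩)`. Since `K` is positive semidefinite,
both forms lie in `[0, M‖H‖²]`, so their difference is at most `M‖H‖²` in absolute value, whence
`2M` and not `4M`. -/

namespace KernelRecovery

/-! ### Frobenius inner product and existence of Riemannian gradients -/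

section FrobeniusInner

theorem frobInner_eq_sum {p q : ℕ} (A B : Matrix (Fin p) (Fin q) ℝ) :
    frobInner A B = ∑ i, ∑ j, A i j * B i j := by
  simp only [frobInner, Matrix.trace, Matrix.diag_apply, Matrix.mul_apply, Matrix.transpose_apply]
  exact Finset.sum_comm

theorem frobenius_norm_sq {p q : ℕ} (A : Matrix (Fin p) (Fin q) ℝ) :
    ‖A‖ ^ 2 = ∑ i, ∑ j, A i j ^ 2 := by
  rw [Matrix.frobenius_norm_def, ← Real.sqrt_eq_rpow, Real.sq_sqrt (by positivity)]
  simp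

theorem frobInner_self {p q : ℕ} (A : Matrix (Fin p) (Fin q) ℝ) : frobInner A A = ‖A‖ ^ 2 := by
  rw [frobInner_eq_sum, frobenius_norm_sq]
  simp only [sq]

theorem frobInner_comm {p q : ℕ} (A B : Matrix (Fin p) (Fin q) ℝ) :
    frobInner A B = frobInner B A := by
  simp only [frobInner_eq_sum, mul_comm]

theorem frobInner_neg_right {p q : ℕ} (A B : Matrix (Fin p) (Fin q) ℝ) :
    frobInner A (-B) = -frobInner A B := by
  simp [frobInner]

theorem abs_frobInner_le {p q : ℕ} (A B : Matrix (Fin p) (Fin q) ℝ) :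
    |frobInner A B| ≤ ‖A‖ * ‖B‖ := by
  refine abs_le_of_sq_le_sq ?_ (by positivity)
  rw [mul_pow, frobenius_norm_sq, frobenius_norm_sq, frobInner_eq_sum]
  simp only [← Fintype.sum_prod_type']
  exact Finset.sum_mul_sq_le_sq_mul_sq _ _ _

/-- The inner product `trace (Aᵀ B)` as a continuous bilinear form. -/
noncomputable def frobInnerL (p q : ℕ) :
    Matrix (Fin p) (Fin q) ℝ →L[ℝ] Matrix (Fin p) (Fin q) ℝ →L[ℝ] ℝ :=
  LinearMap.mkContinuous₂
    (LinearMap.mk₂ ℝ frobInner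
      (fun A B C => by simp [frobInner, Matrix.add_mul])
      (fun c A B => by simp [frobInner])
      (fun A B C => by simp [frobInner, Matrix.mul_add])
      (fun c A B => by simp [frobInner]))
    1 fun A B => (abs_frobInner_le A B).trans_eq (by rw [one_mul])

theorem hasDerivAt_frobInner {p q : ℕ} {A B : ℝ → Matrix (Fin p) (Fin q) ℝ}
    {A' B' : Matrix (Fin p) (Fin q) ℝ} {t : ℝ} (hA : HasDerivAt A A' t) (hB : HasDerivAt B B' t) :
    HasDerivAt (fun t => frobInner (A t) (B t)) (frobInner (A t) B' + frobInner A' (B t)) t :=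
  (frobInnerL p q).hasDerivAt_of_bilinear (fun _ => hA) fun _ => hB

/-- Matrix multiplication as a continuous bilinear map. -/
noncomputable def matrixMulL (l p q : ℕ) :
    Matrix (Fin l) (Fin p) ℝ →L[ℝ] Matrix (Fin p) (Fin q) ℝ →L[ℝ] Matrix (Fin l) (Fin q) ℝ :=
  LinearMap.mkContinuous₂
    (LinearMap.mk₂ ℝ (fun A B => A * B) Matrix.add_mul Matrix.smul_mul Matrix.mul_add
      fun c A B => Matrix.mul_smul A c B)
    1 fun A B => by simpa using Matrix.frobenius_norm_mul A B

/-- Riesz representation on a subspace of a space of matrices. -/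
theorem exists_mem_frobInner_eq {p q : ℕ} (T : Submodule ℝ (Matrix (Fin p) (Fin q) ℝ))
    (ℓ : Matrix (Fin p) (Fin q) ℝ →ₗ[ℝ] ℝ) :
    ∃ G ∈ T, ∀ Z ∈ T, ℓ Z = frobInner G Z := by
  let Φ : T →ₗ[ℝ] Module.Dual ℝ T :=
    LinearMap.mk₂ ℝ (fun A B : T => frobInnerL p q A B) (by simp)
      (by simp) (by simp) (by simp)
  have hinj : Function.Injective Φ := by
    rw [injective_iff_map_eq_zero]
    intro A hA
    have h : frobInner (A : Matrix (Fin p) (Fin q) ℝ) A = 0 := LinearMap.congr_fun hA A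
    rw [frobInner_self] at h
    exact Subtype.ext (by simpa using h)
  -- Positive definiteness gave injectivity; `T` and its dual have equal dimension.
  obtain ⟨G, hG⟩ := (LinearMap.injective_iff_surjective_of_finrank_eq_finrank
    (Subspace.dual_finrank_eq (K := ℝ) (V := T)).symm).1 hinj (ℓ.comp T.subtype)
  exact ⟨G, G.2, fun Z hZ => (LinearMap.congr_fun hG ⟨Z, hZ⟩).symm⟩

theorem exists_isRiemannianGradient {p q : ℕ} {g : Matrix (Fin p) (Fin q) ℝ → ℝ}
    {x : Matrix (Fin p) (Fin q) ℝ} (T : Submodule ℝ (Matrix (Fin p) (Fin q) ℝ))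
    (hg : DifferentiableAt ℝ g x) : ∃ G, IsRiemannianGradient g x T G := by
  obtain ⟨G, hG, h⟩ := exists_mem_frobInner_eq T (fderiv ℝ g x).toLinearMap
  exact ⟨G, hG, hg, h⟩

end FrobeniusInner

/-! ### Matrices of orthogonal projections -/

section Projection

theorem projMatrix_orthogonal {s : ℕ} (U : Submodule ℝ (EuclideanSpace ℝ (Fin s))) :
    projMatrix Uᗮ = 1 - projMatrix U := by
  rw [projMatrix, projMatrix, Submodule.starProjection_orthogonal', map_sub, map_one]

/-- Full column rank is enough here: the gradient differentiates `V ↦ f X (colSpace V)` over all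
matrices near `W`, orthonormal or not. -/
theorem projMatrix_colSpace {s r : ℕ} {V : Matrix (Fin s) (Fin r) ℝ}
    (hV : IsUnit (Vᵀ * V)) : projMatrix (colSpace V) = V * (Vᵀ * V)⁻¹ * Vᵀ := by
  have hdet : IsUnit (Vᵀ * V).det := (Matrix.isUnit_iff_isUnit_det _).1 hV
  rw [projMatrix, StarAlgEquiv.symm_apply_eq]
  refine ContinuousLinearMap.ext fun x => ?_
  refine Submodule.eq_starProjection_of_mem_of_inner_eq_zero (K := colSpace V) ?_ ?_
  · refine ⟨WithLp.toLp 2 (((Vᵀ * V)⁻¹ * Vᵀ) *ᵥ x.ofLp), ?_⟩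
    apply WithLp.ofLp_injective 2
    simp [Matrix.toLpLin_apply, Matrix.mulVec_mulVec, Matrix.mul_assoc]
  · rintro _ ⟨y, rfl⟩
    have h : Vᵀ * (V * (Vᵀ * V)⁻¹ * Vᵀ) = Vᵀ := by
      rw [← Matrix.mul_assoc, ← Matrix.mul_assoc, Matrix.mul_nonsing_inv _ hdet, Matrix.one_mul]
    have h2 : Vᵀ *ᵥ (x.ofLp - (V * (Vᵀ * V)⁻¹ * Vᵀ) *ᵥ x.ofLp) = 0 := by
      rw [Matrix.mulVec_sub, Matrix.mulVec_mulVec, h, sub_self]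
    rw [EuclideanSpace.inner_eq_star_dotProduct]
    simp only [star_trivial, WithLp.ofLp_sub, Matrix.ofLp_toEuclideanCLM, Matrix.toLpLin_apply]
    rw [dotProduct_comm, Matrix.dotProduct_mulVec, ← Matrix.mulVec_transpose, h2, zero_dotProduct]

theorem projMatrix_colSpace_of_mem_stiefel {s r : ℕ} {W : Matrix (Fin s) (Fin r) ℝ}
    (hW : W ∈ stiefel s r) : projMatrix (colSpace W) = W * Wᵀ := by
  have h : Wᵀ * W = 1 := hW
  rw [projMatrix_colSpace (by rw [h]; exact isUnit_one), h]
  simp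

theorem projMatrix_orthogonal_colSpace {s r : ℕ} {W : Matrix (Fin s) (Fin r) ℝ}
    (hW : W ∈ stiefel s r) : projMatrix (colSpace W)ᗮ = 1 - W * Wᵀ := by
  rw [projMatrix_orthogonal, projMatrix_colSpace_of_mem_stiefel hW]

theorem transpose_projMatrix_orthogonal_colSpace {s r : ℕ} {W : Matrix (Fin s) (Fin r) ℝ}
    (hW : W ∈ stiefel s r) : (projMatrix (colSpace W)ᗮ)ᵀ = projMatrix (colSpace W)ᗮ := by
  simp [projMatrix_orthogonal_colSpace hW]

theorem projMatrix_orthogonal_colSpace_mul_self {s r : ℕ} {W : Matrix (Fin s) (Fin r) ℝ}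
    (hW : W ∈ stiefel s r) :
    projMatrix (colSpace W)ᗮ * projMatrix (colSpace W)ᗮ = projMatrix (colSpace W)ᗮ := by
  have h : Wᵀ * W = 1 := hW
  have h2 : W * Wᵀ * (W * Wᵀ) = W * Wᵀ := by
    rw [Matrix.mul_assoc, ← Matrix.mul_assoc Wᵀ, h, Matrix.one_mul]
  rw [projMatrix_orthogonal_colSpace hW, Matrix.mul_sub, Matrix.sub_mul 1 _ (W * Wᵀ), h2]
  simp

/-- For a symmetric idempotent, the squared norm is the trace. -/
theorem norm_projMatrix_orthogonal_colSpace {s r : ℕ} {W : Matrix (Fin s) (Fin r) ℝ}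
    (hW : W ∈ stiefel s r) : ‖projMatrix (colSpace W)ᗮ‖ = √((s : ℝ) - r) := by
  have h : Wᵀ * W = 1 := hW
  have h2 : ‖projMatrix (colSpace W)ᗮ‖ ^ 2 = (s : ℝ) - r := by
    rw [← frobInner_self, frobInner, transpose_projMatrix_orthogonal_colSpace hW,
      projMatrix_orthogonal_colSpace_mul_self hW, projMatrix_orthogonal_colSpace hW,
      Matrix.trace_sub, Matrix.trace_mul_comm, h]
    simp
  rw [← h2, Real.sqrt_sq (norm_nonneg _)]

end Projection

/-! ### Taylor remainder bounds on `[0, 1]` -/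

section Taylor

/-- The remainder vanishes at `0` and its derivative is dominated by that of `C / 2 * t ^ 2`. -/
theorem abs_sub_le_of_abs_deriv_sub_le {ψ ψ' : ℝ → ℝ} {C : ℝ}
    (hψ : ∀ t, HasDerivAt ψ (ψ' t) t) (hC : ∀ t, 0 ≤ t → |ψ' t - ψ' 0| ≤ C * t) :
    |ψ 1 - (ψ 0 + ψ' 0)| ≤ C / 2 := by
  have hf : ∀ t, HasDerivAt (fun t => ψ t - (ψ 0 + t * ψ' 0)) (ψ' t - ψ' 0) t := fun t => by
    simpa using (hψ t).fun_sub (((hasDerivAt_id t).mul_const (ψ' 0)).const_add (ψ 0))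
  have hB : ∀ t, HasDerivAt (fun t : ℝ => C / 2 * t ^ 2) (C * t) t := fun t => by
    refine ((hasDerivAt_pow 2 t).const_mul (C / 2)).congr_deriv ?_
    simp only [Nat.cast_ofNat, Nat.add_one_sub_one, pow_one]
    ring
  have := image_norm_le_of_norm_deriv_right_le_deriv_boundary (a := 0) (b := 1)
    (fun t _ => (hf t).continuousAt.continuousWithinAt) (fun t _ => (hf t).hasDerivWithinAt)
    (by simp) hB (fun t ht => hC t ht.1) (Set.right_mem_Icc.2 zero_le_one)
  simpa using this

theorem abs_sub_le_of_abs_deriv_deriv_le {ψ ψ' ψ'' : ℝ → ℝ} {C : ℝ}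
    (hψ : ∀ t, HasDerivAt ψ (ψ' t) t) (hψ' : ∀ t, HasDerivAt ψ' (ψ'' t) t)
    (hC : ∀ t, |ψ'' t| ≤ C) : |ψ 1 - (ψ 0 + ψ' 0)| ≤ C / 2 :=
  abs_sub_le_of_abs_deriv_sub_le hψ fun t ht => by
    simpa using norm_image_sub_le_of_norm_deriv_le_segment'
      (fun x _ => (hψ' x).hasDerivWithinAt) (fun x _ => hC x) t (Set.right_mem_Icc.2 ht)

end Taylor

/-! ### Symmetry, positivity and sparsity of the kernel matrix and its derivative -/

section Kernel

variable {F : Type*} [NormedAddCommGroup F] [InnerProductSpace ℝ F] {n s : ℕ}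
  (φ : (Fin n → ℝ) → F)

theorem transpose_kernelMatrix (X : Matrix (Fin n) (Fin s) ℝ) :
    (kernelMatrix φ X)ᵀ = kernelMatrix φ X := by
  ext i j
  exact real_inner_comm _ _

/-- Gram structure: each column of `A` contributes the squared norm of the corresponding combination
of feature vectors. -/
theorem frobInner_kernelMatrix_mul_nonneg {q : ℕ} (X : Matrix (Fin n) (Fin s) ℝ)
    (A : Matrix (Fin s) (Fin q) ℝ) : 0 ≤ frobInner A (kernelMatrix φ X * A) := by
  have h : frobInner A (kernelMatrix φ X * A) =
      ∑ k, inner ℝ (∑ i, A i k • φ (Xᵀ i)) (∑ j, A j k • φ (Xᵀ j)) := by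
    rw [frobInner_eq_sum, Finset.sum_comm]
    simp only [Matrix.mul_apply, kernelMatrix, Matrix.of_apply, sum_inner, inner_sum,
      inner_smul_left, inner_smul_right, Finset.mul_sum, RCLike.conj_to_real]
    exact Finset.sum_congr rfl fun k _ => Finset.sum_congr rfl fun i _ =>
      Finset.sum_congr rfl fun j _ => by rw [real_inner_comm]; ring
  rw [h]
  exact Finset.sum_nonneg fun k _ => real_inner_self_nonneg

theorem frobInner_mul_le {p q : ℕ} (K : Matrix (Fin p) (Fin p) ℝ) (A : Matrix (Fin p) (Fin q) ℝ) :
    frobInner A (K * A) ≤ ‖K‖ * ‖A‖ ^ 2 := by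
  calc frobInner A (K * A) ≤ ‖A‖ * ‖K * A‖ := (le_abs_self _).trans (abs_frobInner_le _ _)
    _ ≤ ‖A‖ * (‖K‖ * ‖A‖) := by gcongr; exact Matrix.frobenius_norm_mul _ _
    _ = ‖K‖ * ‖A‖ ^ 2 := by ring

variable {φ}

theorem transpose_kernelDeriv_apply {X : Matrix (Fin n) (Fin s) ℝ}
    (hX : DifferentiableAt ℝ (kernelMatrix φ) X) (Z : Matrix (Fin n) (Fin s) ℝ) :
    (kernelDeriv φ X Z)ᵀ = kernelDeriv φ X Z := by
  let τ : Matrix (Fin s) (Fin s) ℝ →L[ℝ] Matrix (Fin s) (Fin s) ℝ :=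
    LinearMap.toContinuousLinearMap (Matrix.transposeLinearEquiv _ _ ℝ ℝ).toLinearMap
  have h1 := τ.hasFDerivAt.comp X hX.hasFDerivAt
  have h2 : τ ∘ kernelMatrix φ (s := s) = kernelMatrix φ :=
    funext fun Y => transpose_kernelMatrix φ Y
  rw [h2] at h1
  exact DFunLike.congr_fun (h1.unique hX.hasFDerivAt) Z

/-- The entry `k(xᵢ, xⱼ)` of the kernel matrix does not change with the other columns. -/
theorem kernelDeriv_single_apply_eq_zero {X : Matrix (Fin n) (Fin s) ℝ}
    (hX : DifferentiableAt ℝ (kernelMatrix φ) X) (a : Fin n) {l i j : Fin s}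
    (hi : i ≠ l) (hj : j ≠ l) : kernelDeriv φ X (Matrix.single a l 1) i j = 0 := by
  let ε : Matrix (Fin s) (Fin s) ℝ →L[ℝ] ℝ :=
    LinearMap.toContinuousLinearMap (Matrix.entryLinearMap ℝ ℝ i j)
  let c : ℝ → Matrix (Fin n) (Fin s) ℝ := fun t => X + t • Matrix.single a l 1
  have hc : HasDerivAt c (Matrix.single a l 1) 0 :=
    (((hasDerivAt_id (0 : ℝ)).smul_const _).const_add X).congr_deriv (one_smul _ _)
  have hX' : HasFDerivAt (kernelMatrix φ) (fderiv ℝ (kernelMatrix φ) X) (c 0) := by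
    simpa [c] using hX.hasFDerivAt
  have h1 := ε.hasFDerivAt.comp_hasDerivAt (0 : ℝ) (hX'.comp_hasDerivAt (0 : ℝ) hc)
  have hcol : ∀ t, ∀ k ≠ l, (c t)ᵀ k = Xᵀ k := fun t k hk => by
    ext b
    simp [c, hk.symm]
  have h2 : ε ∘ kernelMatrix φ ∘ c = fun _ => kernelMatrix φ X i j := by
    funext t
    change inner ℝ (φ ((c t)ᵀ i)) (φ ((c t)ᵀ j)) = inner ℝ (φ (Xᵀ i)) (φ (Xᵀ j))
    rw [hcol t i hi, hcol t j hj]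
  rw [h2] at h1
  exact h1.unique (hasDerivAt_const _ _)

end Kernel

/-- For an orthogonal projection `P` and a symmetric `U` supported on the cross formed by the row
and column `l`, the pairing `trace (P U)` is at most `‖U‖`: only row `l` of `P` matters. -/
theorem abs_trace_mul_le_of_support_cross {s : ℕ} {P U : Matrix (Fin s) (Fin s) ℝ}
    (hP : Pᵀ = P) (hPP : P * P = P) (hU : Uᵀ = U) (l : Fin s)
    (hl : ∀ i j, i ≠ l → j ≠ l → U i j = 0) : |(P * U).trace| ≤ ‖U‖ := by
  have hUs : ∀ i j, U i j = U j i := fun i j => congrFun (congrFun hU j) i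
  have hPs : ∀ i j, P i j = P j i := fun i j => congrFun (congrFun hP j) i
  -- The row and the column of the cross have equal sums, and the corner is counted twice.
  have split : ∀ f : Fin s → Fin s → ℝ, (∀ i j, f i j = f j i) →
      (∀ i j, i ≠ l → j ≠ l → f i j = 0) →
      ∑ i, ∑ j, f i j = 2 * ∑ j, f l j - f l l := by
    intro f hf h0
    have h1 : ∀ i ∈ Finset.univ.erase l, ∑ j, f i j = f l i := fun i hi => by
      rw [Finset.sum_eq_single l (fun j _ hj => h0 i j (Finset.ne_of_mem_erase hi) hj) (by simp),
        hf]
    rw [← Finset.add_sum_erase _ _ (Finset.mem_univ l), Finset.sum_congr rfl h1,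
      ← Finset.add_sum_erase _ (fun j => f l j) (Finset.mem_univ l)]
    ring
  have htr : (P * U).trace = ∑ j, P l j * U l j + ∑ j ∈ Finset.univ.erase l, P l j * U l j := by
    have h1 : (P * U).trace = frobInner P U := by rw [frobInner, hP]
    rw [h1, frobInner_eq_sum, split (fun i j => P i j * U i j)
      (fun i j => by rw [hPs, hUs]) (fun i j hi hj => by simp [hl i j hi hj]),
      ← Finset.add_sum_erase _ (fun j => P l j * U l j) (Finset.mem_univ l)]
    ring
  have hnorm : ‖U‖ ^ 2 = ∑ j, U l j ^ 2 + ∑ j ∈ Finset.univ.erase l, U l j ^ 2 := by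
    rw [frobenius_norm_sq, split (fun i j => U i j ^ 2)
      (fun i j => by rw [hUs]) (fun i j hi hj => by simp [hl i j hi hj]),
      ← Finset.add_sum_erase _ (fun j => U l j ^ 2) (Finset.mem_univ l)]
    ring
  have hrow : P l l = ∑ j, P l j ^ 2 := by
    conv_lhs => rw [← hPP, Matrix.mul_apply]
    exact Finset.sum_congr rfl fun j _ => by rw [hPs j l, sq]
  rw [← Finset.add_sum_erase _ _ (Finset.mem_univ l)] at htr hnorm hrow
  set E := Finset.univ.erase l
  set p := ∑ j ∈ E, P l j ^ 2
  set u := ∑ j ∈ E, U l j ^ 2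
  set c := ∑ j ∈ E, P l j * U l j
  have hcs : c ^ 2 ≤ p * u := Finset.sum_mul_sq_le_sq_mul_sq _ _ _
  have hu : 0 ≤ u := Finset.sum_nonneg fun _ _ => sq_nonneg _
  refine abs_le_of_sq_le_sq ?_ (norm_nonneg _)
  rw [htr, hnorm]
  -- With `hcs`, this yields Cauchy-Schwarz with weight 1 on the corner and weight 2 off it.
  have hcross : 0 ≤ P l l ^ 2 * u + U l l ^ 2 * p - 2 * (P l l * U l l) * c := by
    have h : 0 ≤ ∑ j ∈ E, (P l l * U l j - U l l * P l j) ^ 2 :=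
      Finset.sum_nonneg fun _ _ => sq_nonneg _
    refine h.trans_eq ?_
    simp only [p, u, c, Finset.mul_sum, ← Finset.sum_add_distrib, ← Finset.sum_sub_distrib]
    exact Finset.sum_congr rfl fun j _ => by ring
  calc (P l l * U l l + c + c) ^ 2
      ≤ (P l l ^ 2 + 2 * p) * (U l l ^ 2 + 2 * u) := by nlinarith only [hcs, hcross]
    -- By `hrow`, `P l l ^ 2 + 2 * p = 2 * P l l - P l l ^ 2 = 1 - (1 - P l l) ^ 2`.
    _ ≤ 1 * (U l l ^ 2 + 2 * u) := by
        gcongr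
        nlinarith [sq_nonneg (1 - P l l)]
    _ = U l l ^ 2 + u + u := by ring

/-! ### The bound in the direction of the measurement space -/

section MeasurementDirection

variable {F : Type*} [NormedAddCommGroup F] [InnerProductSpace ℝ F] {n s m r : ℕ}
  {φ : (Fin n → ℝ) → F}

theorem grassExp_zero {W : Matrix (Fin s) (Fin r) ℝ} : grassExp W 0 = colSpace W := by
  simp [grassExp, grassGeodesic]

/-- The linear functional `A ↦ trace (P_{𝒲⊥} A)`. -/
noncomputable def traceProjL (𝒲 : Submodule ℝ (EuclideanSpace ℝ (Fin s))) :
    Matrix (Fin s) (Fin s) ℝ →L[ℝ] ℝ :=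
  LinearMap.toContinuousLinearMap
    (Matrix.traceLinearMap (Fin s) ℝ ℝ ∘ₗ LinearMap.mulLeft ℝ (projMatrix 𝒲ᗮ))

theorem traceProjL_apply (𝒲 : Submodule ℝ (EuclideanSpace ℝ (Fin s)))
    (A : Matrix (Fin s) (Fin s) ℝ) : traceProjL 𝒲 A = (projMatrix 𝒲ᗮ * A).trace := rfl

theorem hasFDerivAt_kernelCost {X : Matrix (Fin n) (Fin s) ℝ}
    (hX : DifferentiableAt ℝ (kernelMatrix φ) X)
    (𝒲 : Submodule ℝ (EuclideanSpace ℝ (Fin s))) :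
    HasFDerivAt (fun Y => kernelCost φ Y 𝒲)
      ((traceProjL 𝒲).comp (fderiv ℝ (kernelMatrix φ) X)) X :=
  (traceProjL 𝒲).hasFDerivAt.comp X hX.hasFDerivAt

theorem abs_traceProjL_colSpace_le {W : Matrix (Fin s) (Fin r) ℝ} (hW : W ∈ stiefel s r)
    (A : Matrix (Fin s) (Fin s) ℝ) : |traceProjL (colSpace W) A| ≤ √((s : ℝ) - r) * ‖A‖ := by
  have h : traceProjL (colSpace W) A = frobInner (projMatrix (colSpace W)ᗮ) A := by
    rw [frobInner, transpose_projMatrix_orthogonal_colSpace hW, traceProjL_apply]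
  rw [h, ← norm_projMatrix_orthogonal_colSpace hW]
  exact abs_frobInner_le _ _

/-- The cross estimate bounds the functional on each column of the Jacobian difference by that
column's norm; Cauchy-Schwarz over the coordinates of `Z` then assembles the columns. -/
theorem abs_traceProjL_kernelDeriv_sub_le {X₁ X₂ : Matrix (Fin n) (Fin s) ℝ}
    (h₁ : DifferentiableAt ℝ (kernelMatrix φ) X₁) (h₂ : DifferentiableAt ℝ (kernelMatrix φ) X₂)
    {W : Matrix (Fin s) (Fin r) ℝ} (hW : W ∈ stiefel s r) (Z : Matrix (Fin n) (Fin s) ℝ) :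
    |traceProjL (colSpace W) (kernelDeriv φ X₁ Z - kernelDeriv φ X₂ Z)| ≤
      jacobianFrobNorm (kernelDeriv φ X₁ - kernelDeriv φ X₂) * ‖Z‖ := by
  set D := kernelDeriv φ X₁ - kernelDeriv φ X₂ with hD
  have hcol : ∀ a l, |traceProjL (colSpace W) (D (Matrix.single a l 1))| ≤
      ‖D (Matrix.single a l 1)‖ := fun a l => by
    rw [traceProjL_apply]
    refine abs_trace_mul_le_of_support_cross (transpose_projMatrix_orthogonal_colSpace hW)
      (projMatrix_orthogonal_colSpace_mul_self hW) ?_ l fun i j hi hj => ?_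
    · rw [hD, LinearMap.sub_apply, Matrix.transpose_sub, transpose_kernelDeriv_apply h₁,
        transpose_kernelDeriv_apply h₂]
    · rw [hD, LinearMap.sub_apply, Matrix.sub_apply, kernelDeriv_single_apply_eq_zero h₁ a hi hj,
        kernelDeriv_single_apply_eq_zero h₂ a hi hj, sub_zero]
  have hZ : traceProjL (colSpace W) (D Z) =
      frobInner (Matrix.of fun a l => traceProjL (colSpace W) (D (Matrix.single a l 1))) Z := by
    rw [frobInner_eq_sum]
    conv_lhs => rw [Matrix.matrix_eq_sum_single Z]
    simp only [map_sum, Matrix.of_apply]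
    refine Finset.sum_congr rfl fun a _ => Finset.sum_congr rfl fun l _ => ?_
    rw [show Matrix.single a l (Z a l) = Z a l • Matrix.single a l (1 : ℝ) by simp, map_smul,
      map_smul, smul_eq_mul, mul_comm]
  rw [← LinearMap.sub_apply, ← hD, hZ]
  refine (abs_frobInner_le _ _).trans ?_
  gcongr
  refine Real.le_sqrt_of_sq_le ?_
  rw [frobenius_norm_sq]
  refine Finset.sum_le_sum fun a _ => Finset.sum_le_sum fun l _ => ?_
  rw [Matrix.of_apply, ← sq_abs]
  exact pow_le_pow_left₀ (abs_nonneg _) (hcol a l) 2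

/-- Stated for an abstract constant `C` so that it serves both norms on `DK`. The whole line `X + t
• η` stays in the affine space, so the hypotheses apply along it. -/
theorem pullbackLipschitzX_kernelCost {𝒜 : Matrix (Fin n) (Fin s) ℝ →ₗ[ℝ] (Fin m → ℝ)}
    {b : Fin m → ℝ} {C : ℝ}
    (hdiff : ∀ X ∈ measurementSpace 𝒜 b, DifferentiableAt ℝ (kernelMatrix φ (s := s)) X)
    (hC : ∀ X₁ ∈ measurementSpace 𝒜 b, ∀ X₂ ∈ measurementSpace 𝒜 b, ∀ W ∈ stiefel s r,
      ∀ Z, |traceProjL (colSpace W) (kernelDeriv φ X₁ Z - kernelDeriv φ X₂ Z)| ≤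
        C * ‖X₁ - X₂‖ * ‖Z‖) :
    PullbackLipschitzX r (kernelCost φ) 𝒜 b C := by
  intro X hX W hW
  have hd := hasFDerivAt_kernelCost (hdiff X hX) (colSpace W)
  obtain ⟨G, hG⟩ := exists_isRiemannianGradient (LinearMap.ker 𝒜) hd.differentiableAt
  refine ⟨G, hG, fun η hη => ?_⟩
  have hmem : ∀ t : ℝ, X + t • η ∈ measurementSpace 𝒜 b := fun t => by
    have h1 : 𝒜 X = b := hX
    have h2 : 𝒜 η = 0 := hη
    simp [measurementSpace, h1, h2]
  have hcurve : ∀ t : ℝ, HasDerivAt (fun t : ℝ => kernelCost φ (X + t • η) (colSpace W))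
      (traceProjL (colSpace W) (kernelDeriv φ (X + t • η) η)) t := fun t => by
    have hc : HasDerivAt (fun t : ℝ => X + t • η) η t :=
      (((hasDerivAt_id t).smul_const η).const_add X).congr_deriv (one_smul _ _)
    have hf := hasFDerivAt_kernelCost (hdiff _ (hmem t)) (colSpace W)
    exact HasFDerivAt.comp_hasDerivAt (f := fun t : ℝ => X + t • η) t hf hc
  have key := abs_sub_le_of_abs_deriv_sub_le (C := C * ‖η‖ ^ 2) hcurve fun t ht => by
    rw [← map_sub]
    refine (hC _ (hmem t) _ (hmem 0) W hW η).trans_eq ?_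
    rw [zero_smul, add_zero, add_sub_cancel_left, norm_smul, Real.norm_of_nonneg ht]
    ring
  have hgrad : frobInner G η = traceProjL (colSpace W) (kernelDeriv φ X η) := by
    rw [← hG.2.2 η hη, hd.fderiv]
    rfl
  simp only [one_smul, zero_smul, add_zero] at key
  rw [hgrad, expRetr, Function.uncurry_apply_pair, grassExp_zero]
  exact key.trans_eq (by ring)

end MeasurementDirection

/-! ### The bound in the Grassmann direction -/

section GrassmannDirection

theorem hasDerivAt_exp_smul_mul {s r : ℕ} (Ω : Matrix (Fin s) (Fin s) ℝ)
    (V : Matrix (Fin s) (Fin r) ℝ) (t : ℝ) :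
    HasDerivAt (fun t : ℝ => NormedSpace.exp (t • Ω) * V)
      (NormedSpace.exp (t • Ω) * (Ω * V)) t := by
  rw [← Matrix.mul_assoc]
  exact ((matrixMulL s s r).flip V).hasFDerivAt.comp_hasDerivAt t (hasDerivAt_exp_smul_const Ω t)

/-- A geodesic of the Grassmann manifold lifts to a curve of orthonormal matrices with velocities
of constant speed and acceleration `-γ Hᵀ H`. -/
theorem exists_hasDerivAt_grassGeodesic {s r : ℕ} {W H : Matrix (Fin s) (Fin r) ℝ}
    (hW : W ∈ stiefel s r) (hH : H ∈ horizontal W) :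
    ∃ γ' : ℝ → Matrix (Fin s) (Fin r) ℝ,
      (∀ t, HasDerivAt (grassGeodesic W H) (γ' t) t) ∧
      (∀ t, HasDerivAt γ' (-(grassGeodesic W H t * (Hᵀ * H))) t) ∧
      ∀ t, ‖γ' t‖ = ‖H‖ := by
  have hW' : Wᵀ * W = 1 := hW
  have hH' : Wᵀ * H = 0 := hH
  have hHW : Hᵀ * W = 0 := by simpa using congrArg Matrix.transpose hH'
  -- `Ω` is skew, so `exp (t • Ω)` is orthogonal and preserves the Frobenius norm.
  set Ω := H * Wᵀ - W * Hᵀ with hΩ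
  have hΩW : Ω * W = H := by
    rw [hΩ, Matrix.sub_mul, Matrix.mul_assoc, Matrix.mul_assoc, hW', hHW]; simp
  have hΩH : Ω * H = -(W * (Hᵀ * H)) := by
    rw [hΩ, Matrix.sub_mul, Matrix.mul_assoc, Matrix.mul_assoc, hH']; simp
  have hskew : Ωᵀ = -Ω := by simp [hΩ]
  have hexp : ∀ t : ℝ, (NormedSpace.exp (t • Ω))ᵀ * NormedSpace.exp (t • Ω) = 1 := fun t => by
    rw [← Matrix.exp_transpose, Matrix.transpose_smul, hskew, smul_neg,
      ← Matrix.exp_add_of_commute _ _ (Commute.refl (t • Ω)).neg_left, neg_add_cancel,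
      NormedSpace.exp_zero]
  refine ⟨fun t => NormedSpace.exp (t • Ω) * H, fun t => ?_, fun t => ?_, fun t => ?_⟩
  · have h := hasDerivAt_exp_smul_mul Ω W t
    rwa [hΩW] at h
  · refine (hasDerivAt_exp_smul_mul Ω H t).congr_deriv ?_
    rw [hΩH, Matrix.mul_neg, ← Matrix.mul_assoc]
    rfl
  · rw [← sq_eq_sq₀ (norm_nonneg _) (norm_nonneg _), ← frobInner_self, ← frobInner_self,
      frobInner, frobInner, Matrix.transpose_mul, Matrix.mul_assoc, ← Matrix.mul_assoc _ _ H,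
      hexp, Matrix.one_mul]

variable {F : Type*} [NormedAddCommGroup F] [InnerProductSpace ℝ F] {n s m r : ℕ}
  {φ : (Fin n → ℝ) → F}

theorem kernelCost_colSpace {X : Matrix (Fin n) (Fin s) ℝ} {V : Matrix (Fin s) (Fin r) ℝ}
    (hV : IsUnit (Vᵀ * V)) :
    kernelCost φ X (colSpace V) =
      (kernelMatrix φ X).trace - frobInner V (kernelMatrix φ X * (V * (Vᵀ * V)⁻¹)) := by
  rw [kernelCost, projMatrix_orthogonal, projMatrix_colSpace hV, Matrix.sub_mul, Matrix.one_mul,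
    Matrix.trace_sub, frobInner, Matrix.mul_assoc, Matrix.trace_mul_comm, Matrix.mul_assoc]

theorem kernelCost_colSpace_of_mem_stiefel {X : Matrix (Fin n) (Fin s) ℝ}
    {W : Matrix (Fin s) (Fin r) ℝ} (hW : W ∈ stiefel s r) :
    kernelCost φ X (colSpace W) =
      (kernelMatrix φ X).trace - frobInner W (kernelMatrix φ X * W) := by
  have h : Wᵀ * W = 1 := hW
  rw [kernelCost_colSpace (by rw [h]; exact isUnit_one), h]
  simp

theorem differentiableAt_kernelCost_colSpace (X : Matrix (Fin n) (Fin s) ℝ)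
    {W : Matrix (Fin s) (Fin r) ℝ} (hW : W ∈ stiefel s r) :
    DifferentiableAt ℝ (fun V : Matrix (Fin s) (Fin r) ℝ => kernelCost φ X (colSpace V)) W := by
  have hunit : IsUnit (Wᵀ * W) := by
    rw [show Wᵀ * W = 1 from hW]
    exact isUnit_one
  let τ : Matrix (Fin s) (Fin r) ℝ →L[ℝ] Matrix (Fin r) (Fin s) ℝ :=
    LinearMap.toContinuousLinearMap (Matrix.transposeLinearEquiv _ _ ℝ ℝ).toLinearMap
  have hgram : Differentiable ℝ fun V : Matrix (Fin s) (Fin r) ℝ => Vᵀ * V := fun V =>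
    ((matrixMulL r s r).hasFDerivAt_of_bilinear τ.hasFDerivAt (hasFDerivAt_id V)).differentiableAt
  have hinv : DifferentiableAt ℝ (fun V : Matrix (Fin s) (Fin r) ℝ => (Vᵀ * V)⁻¹) W := by
    simp only [Matrix.nonsing_inv_eq_ringInverse]
    exact DifferentiableAt.comp (f := fun V : Matrix (Fin s) (Fin r) ℝ => Vᵀ * V) W
      (differentiableAt_inverse hunit) (hgram W)
  have hmul : DifferentiableAt ℝ (fun V : Matrix (Fin s) (Fin r) ℝ => V * (Vᵀ * V)⁻¹) W :=
    ((matrixMulL s r r).hasFDerivAt_of_bilinear (hasFDerivAt_id W)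
      hinv.hasFDerivAt).differentiableAt
  have hK : DifferentiableAt ℝ
      (fun V : Matrix (Fin s) (Fin r) ℝ => kernelMatrix φ X * (V * (Vᵀ * V)⁻¹)) W :=
    (matrixMulL s s r (kernelMatrix φ X)).differentiableAt.comp W hmul
  have hform : DifferentiableAt ℝ (fun V : Matrix (Fin s) (Fin r) ℝ =>
      frobInner V (kernelMatrix φ X * (V * (Vᵀ * V)⁻¹))) W :=
    ((frobInnerL s r).hasFDerivAt_of_bilinear (hasFDerivAt_id W) hK.hasFDerivAt).differentiableAt
  -- The closed formula needs an invertible Gram matrix `Vᵀ * V`, an open condition satisfied at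
  -- `W`.
  refine (hform.const_sub (kernelMatrix φ X).trace).congr_of_eventuallyEq ?_
  filter_upwards [hgram.continuous.continuousAt.eventually (Units.isOpen.mem_nhds hunit)] with V hV
  exact kernelCost_colSpace hV

theorem pullbackLipschitzU_kernelCost {𝒜 : Matrix (Fin n) (Fin s) ℝ →ₗ[ℝ] (Fin m → ℝ)}
    {b : Fin m → ℝ} {M : ℝ} (hM : ∀ X ∈ measurementSpace 𝒜 b, ‖kernelMatrix φ X‖ ≤ M) :
    PullbackLipschitzU r (kernelCost φ) 𝒜 b (2 * M) := by
  intro X hX W hW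
  have hd := differentiableAt_kernelCost_colSpace (φ := φ) X hW
  obtain ⟨G, hG⟩ := exists_isRiemannianGradient (horizontal W) hd
  refine ⟨G, hG, fun H hH => ?_⟩
  obtain ⟨⟨-, -, -, -, hst, -⟩, hγ0, hγd⟩ := isHorizontalGeodesic_grassGeodesic hW hH
  obtain ⟨γ', h1, h2, hspeed⟩ := exists_hasDerivAt_grassGeodesic hW hH
  set γ := grassGeodesic W H
  set K := kernelMatrix φ X with hK
  have hsymm : ∀ A B : Matrix (Fin s) (Fin r) ℝ, frobInner A (K * B) = frobInner B (K * A) :=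
    fun A B => by
      rw [frobInner_comm, frobInner, frobInner, Matrix.transpose_mul, transpose_kernelMatrix,
        Matrix.mul_assoc]
  have hKd : ∀ {c : ℝ → Matrix (Fin s) (Fin r) ℝ} {c' : Matrix (Fin s) (Fin r) ℝ} {t : ℝ},
      HasDerivAt c c' t → HasDerivAt (fun t => K * c t) (K * c') t := fun hc =>
    (matrixMulL s s r K).hasFDerivAt.comp_hasDerivAt _ hc
  have hcurve : ∀ t, HasDerivAt (fun t => kernelCost φ X (colSpace (γ t)))
      (-2 * frobInner (γ t) (K * γ' t)) t := fun t => by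
    have h := (hasDerivAt_frobInner (h1 t) (hKd (h1 t))).const_sub K.trace
    refine (h.congr_of_eventuallyEq (.of_forall fun u =>
      kernelCost_colSpace_of_mem_stiefel (hst u))).congr_deriv ?_
    rw [hsymm (γ' t)]
    ring
  -- Cyclicity of the trace rewrites the acceleration term as a quadratic form in `γ t * Hᵀ`, which
  -- makes its sign visible.
  have hcurve' : ∀ t, HasDerivAt (fun t => -2 * frobInner (γ t) (K * γ' t))
      (-2 * (frobInner (γ' t) (K * γ' t) - frobInner (γ t * Hᵀ) (K * (γ t * Hᵀ)))) t := fun t => by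
    refine ((hasDerivAt_frobInner (h1 t) (hKd (h2 t))).const_mul (-2 : ℝ)).congr_deriv ?_
    have h : frobInner (γ t * Hᵀ) (K * (γ t * Hᵀ)) = frobInner (γ t) (K * (γ t * (Hᵀ * H))) := by
      rw [frobInner, frobInner, Matrix.transpose_mul, Matrix.transpose_transpose, Matrix.mul_assoc,
        Matrix.trace_mul_comm]
      simp only [Matrix.mul_assoc]
    rw [Matrix.mul_neg, h, frobInner_neg_right]
    ring
  have hnorm : ∀ t, ‖γ t * Hᵀ‖ ^ 2 = ‖H‖ ^ 2 := fun t => by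
    have h : (γ t)ᵀ * γ t = 1 := hst t
    rw [← frobInner_self, ← frobInner_self, frobInner, Matrix.transpose_mul, Matrix.mul_assoc,
      ← Matrix.mul_assoc _ (γ t), h, Matrix.one_mul, Matrix.transpose_transpose,
      Matrix.trace_mul_comm, frobInner]
  -- Two numbers in `[0, M * ‖H‖ ^ 2]` differ by at most `M * ‖H‖ ^ 2`; the remaining 2 is the
  -- prefactor of the second derivative.
  have key := abs_sub_le_of_abs_deriv_deriv_le (C := 2 * M * ‖H‖ ^ 2) hcurve hcurve' fun t => by
    have hKM : ‖K‖ * ‖H‖ ^ 2 ≤ M * ‖H‖ ^ 2 := by gcongr; exact hM X hX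
    have a1 := frobInner_kernelMatrix_mul_nonneg φ X (γ' t)
    have a2 := frobInner_mul_le K (γ' t)
    have b1 := frobInner_kernelMatrix_mul_nonneg φ X (γ t * Hᵀ)
    have b2 := frobInner_mul_le K (γ t * Hᵀ)
    rw [← hK] at a1 b1
    rw [hspeed] at a2
    rw [hnorm] at b2
    rw [abs_le]
    constructor <;> linarith
  -- Both sides are the derivative at `0` of the cost along `γ`, so no explicit formula for `G` is
  -- needed.
  have hgrad : frobInner G H = -2 * frobInner (γ 0) (K * γ' 0) := by
    rw [← hG.2.2 H hH]
    rw [← hγ0] at hd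
    have h := hd.hasFDerivAt.comp_hasDerivAt (0 : ℝ) hγd
    rw [hγ0] at h
    exact h.unique (hcurve 0)
  rw [← hgrad] at key
  simp only [hγ0] at key
  rw [expRetr, Function.uncurry_apply_pair, add_zero]
  exact key.trans_eq (by ring)

end GrassmannDirection

end KernelRecovery

theorem mainTheorem7 {F : Type*} [NormedAddCommGroup F] [InnerProductSpace ℝ F] {n s m : ℕ} (r : ℕ)
    (φ : (Fin n → ℝ) → F)
    (𝒜 : Matrix (Fin n) (Fin s) ℝ →ₗ[ℝ] (Fin m → ℝ)) (b : Fin m → ℝ) :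
    ((∀ X ∈ KernelRecovery.measurementSpace 𝒜 b,
        DifferentiableAt ℝ (KernelRecovery.kernelMatrix φ (s := s)) X) →
      (∀ L : ℝ,
        (∀ X₁ ∈ KernelRecovery.measurementSpace 𝒜 b, ∀ X₂ ∈ KernelRecovery.measurementSpace 𝒜 b,
          KernelRecovery.jacobianFrobNorm
            (KernelRecovery.kernelDeriv φ X₁ - KernelRecovery.kernelDeriv φ X₂)
              ≤ L * ‖X₁ - X₂‖) →
        KernelRecovery.PullbackLipschitzX r (KernelRecovery.kernelCost φ) 𝒜 b L) ∧
      (∀ L : ℝ,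
        (∀ X₁ ∈ KernelRecovery.measurementSpace 𝒜 b, ∀ X₂ ∈ KernelRecovery.measurementSpace 𝒜 b,
          ∀ Z : Matrix (Fin n) (Fin s) ℝ,
            ‖KernelRecovery.kernelDeriv φ X₁ Z - KernelRecovery.kernelDeriv φ X₂ Z‖
              ≤ L * ‖X₁ - X₂‖ * ‖Z‖) →
        KernelRecovery.PullbackLipschitzX r (KernelRecovery.kernelCost φ) 𝒜 b
          (Real.sqrt ((s : ℝ) - (r : ℝ)) * L))) ∧
    (∀ M : ℝ, (∀ X ∈ KernelRecovery.measurementSpace 𝒜 b,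
        ‖KernelRecovery.kernelMatrix φ X‖ ≤ M) →
      KernelRecovery.PullbackLipschitzU r (KernelRecovery.kernelCost φ) 𝒜 b (2 * M)) := by
  refine ⟨fun hdiff => ⟨fun L hL => ?_, fun L hL => ?_⟩, fun M hM =>
    KernelRecovery.pullbackLipschitzU_kernelCost hM⟩
  · refine KernelRecovery.pullbackLipschitzX_kernelCost hdiff fun X₁ h₁ X₂ h₂ W hW Z => ?_
    refine (KernelRecovery.abs_traceProjL_kernelDeriv_sub_le (hdiff X₁ h₁) (hdiff X₂ h₂)
      hW Z).trans ?_
    gcongr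
    exact hL X₁ h₁ X₂ h₂
  · refine KernelRecovery.pullbackLipschitzX_kernelCost hdiff fun X₁ h₁ X₂ h₂ W hW Z => ?_
    refine (KernelRecovery.abs_traceProjL_colSpace_le hW _).trans ?_
    rw [mul_assoc √_, mul_assoc √_]
    gcongr
    exact hL X₁ h₁ X₂ h₂ Z
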